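/- **Setting.** All maps are $C^\infty$; manifolds are real, Hausdorff, second countable, connected. Let $\pi:Y\to X$ be a fibred manifold (a surjective submersion), $\dim X=n$, $\dim Y=n+m$, with fibred coordinates $(x^\lambda,y^i)$, and put $\omega=dx^1\wedge\dots\wedge dx^n$, $\omega_\lambda=\partial_\lambda\rfloor\omega$. The first order jet manifold $J^1Y$ has adapted coordinates $(x^\lambda,y^i,y^i_\lambda)$; the Legendre manifold $\Pi=\bigwedge^nT^*X\otimes_Y TX\otimes_Y V^*Y$ has coordinates $(x^\lambda,y^i,p^\lambda_i)$, the point with these coordinates being $p^\lambda_i\,\omega\otimes\partial_\lambda\otimes dy^i$. The jet manifolds $J^1J^1Y$ of $J^1Y\to X$ and $J^1\Pi$ of $\Pi\to X$ have coordinates $(x^\lambda,y^i,y^i_\lambda,y^i_{(\mu)},y^i_{\lambda\mu})$ and $(x^\lambda,y^i,p^\lambda_i,y^i_{(\mu)},p^\lambda_{i\mu})$. *Lagrangian side.* Let $L=\mathcal L\,\omega$ be a Lagrangian density, i.e. a horizontal density on $J^1Y\to X$; put $\pi^\lambda_i=\partial\mathcal L/\partial y^i_\lambda$. The Legendre morphism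 is $\widehat L:J^1Y\to\Pi$, $p^\lambda_i\circ\widehat L=\pi^\lambda_i$, and $Q=\widehat L(J^1Y)$. $L$ is *semiregular* if $\widehat L^{-1}(q)$ is a connected (possibly only immersed) submanifold of $J^1Y$ for every $q\in Q$. Let $$\Xi_L=\pi^\lambda_i\,dy^i\wedge\omega_\lambda-\pi^\lambda_iy^i_\lambda\,\omega+\mathcal L\,\omega,\qquad \Omega_L=\Big(\frac{\partial\pi^\lambda_i}{\partial y^j}dy^j+\frac{\partial\pi^\lambda_i}{\partial y^j_\mu}dy^j_\mu\Big)\wedge dy^i\wedge\omega\otimes\partial_\lambda$$ be the Poincaré–Cartan form and the Lagrangian multisymplectic form. On $J^1J^1Y$, with $\Xi_L,\Omega_L$ pulled back and $\lambda=dx^\lambda\otimes(\partial_\lambda+y^i_{(\lambda)}\partial_i+y^i_{\mu\lambda}\partial^\mu_i)$ the contact map (where $\partial^\mu_i=\partial/\partial y^i_\mu$), put $\Lambda_L=d\Xi_L-\lambda\rfloor\Omega_L$. Here, for $\gamma=dx^\lambda\otimes\gamma_\lambda$ and $\Omega=\Omega^\lambda\otimes\partial_\lambda$, $\gamma\rfloor\Omega=\sum_\lambda\gamma_\lambda\rfloor\Omega^\lambda$.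 *Hamiltonian side.* Let $\Omega=dp^\lambda_i\wedge dy^i\wedge\omega\otimes\partial_\lambda$ on $\Pi$. An exterior $n$-form $H$ on $\Pi$ is a *Hamiltonian form* if near every point of $\Pi$ there is a local section $\gamma$ of $J^1\Pi\to\Pi$, $\gamma=dx^\lambda\otimes(\partial_\lambda+\gamma^i_{(\lambda)}\partial_i+\gamma^\mu_{i\lambda}\,\partial/\partial p^\mu_i)$, such that $\gamma\rfloor\Omega$ is closed and $\gamma\rfloor\Omega=dH$. Modulo closed forms, such an $H$ is locally $p^\lambda_i\,dy^i\wedge\omega_\lambda-\mathcal H\,\omega$; its momentum morphism $\widehat H:\Pi\to J^1Y$ over $Y$ is given by $y^i_\lambda\circ\widehat H=\partial\mathcal H/\partial p^\lambda_i$. The form $H$ is *associated with* $L$ if $\widehat L\circ\widehat H|_Q=\mathrm{Id}_Q$ and, modulo closed forms, $H=H_{\widehat H}+L\circ\widehat H$, where $H_{\widehat H}=p^\lambda_i\,dy^i\wedge\omega_\lambda-p^\lambda_i\,(y^i_\lambda\circ\widehat H)\,\omega$. The *Hamilton operator* of $H$ is the $(n+1)$-form on $J^1\Pi$ $$\mathcal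 E_H=dH-\widehat\Omega,\qquad \widehat\Omega=dp^\lambda_i\wedge dy^i\wedge\omega_\lambda+p^\lambda_{i\lambda}\,dy^i\wedge\omega-y^i_{(\lambda)}\,dp^\lambda_i\wedge\omega ,$$ with $dH$ pulled back to $J^1\Pi$; $\widehat\Omega$ is the contraction of $\Omega$ with the contact map of $J^1\Pi$. **Proposition 9.** Let $H$ be a Hamiltonian form associated with a semiregular Lagrangian density $L$. Then $$\Lambda_L=\mathcal E_H\circ J^1\widehat L ,$$ that is, the form $\Lambda_L$ on $J^1J^1Y$ is the pullback of $\mathcal E_H$ by the jet prolongation $J^1\widehat L:J^1J^1Y\to J^1\Pi$ of the Legendre morphism. -/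

import Mathlib

open scoped Manifold ContDiff TensorProduct
open Set

noncomputable section

namespace Multimomentum

/-! ## Differential forms in coordinates -/

/-- The exterior product `θ 0 ∧ ⋯ ∧ θ (k - 1)` of covectors:
`(v 0, …, v (k - 1)) ↦ det (θ i (v j))`. -/
def wedge {E : Type*} [AddCommGroup E] [Module ℝ E] [TopologicalSpace E] {k : ℕ}
    (θ : Fin k → E →L[ℝ] ℝ) : E [⋀^Fin k]→L[ℝ] ℝ :=
  ContinuousAlternatingMap.compContinuousLinearMap
    ({ toMultilinearMap := (Matrix.detRowAlternating (n := Fin k) (R := ℝ)).toMultilinearMap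
       map_eq_zero_of_eq' := (Matrix.detRowAlternating (n := Fin k) (R := ℝ)).map_eq_zero_of_eq'
       cont := continuous_id.matrix_det } : (Fin k → ℝ) [⋀^Fin k]→L[ℝ] ℝ)
    (ContinuousLinearMap.pi θ)

/-- Coordinates `(x^λ, g)` on a fibred manifold over an `n`-dimensional base, with fibre
coordinates in `G`. -/
abbrev Crd (n : ℕ) (G : Type) : Type := (Fin n → ℝ) × G

/-- Fibre coordinates of the first order jet manifold of a fibred manifold with fibre coordinates
in `G`: the values `g` and the derivatives `g_λ`. -/
abbrev JetFib (n : ℕ) (G : Type) : Type := G × (Fin n → G)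

/-- Fibre coordinates `y^i` of `Y → X`. -/
abbrev YFib (m : ℕ) : Type := Fin m → ℝ

/-- Fibre coordinates `(y^i, p^λ_i)` of the Legendre manifold `Π → X`; `p^λ_i` is the entry
`λ i`. -/
abbrev LegFib (n m : ℕ) : Type := (Fin m → ℝ) × (Fin n → Fin m → ℝ)

section Coordinates

variable {n m : ℕ} {G G' : Type} [NormedAddCommGroup G] [NormedSpace ℝ G]
  [NormedAddCommGroup G'] [NormedSpace ℝ G']

/-- The coordinate vector `∂_μ` of `ℝⁿ`. -/
def e (μ : Fin n) : Fin n → ℝ := Pi.single μ 1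

/-- The covector `dx^μ`. -/
def dx (μ : Fin n) : Crd n G →L[ℝ] ℝ :=
  (ContinuousLinearMap.proj μ).comp (ContinuousLinearMap.fst ℝ (Fin n → ℝ) G)

/-- The form `ω = dx^1 ∧ ⋯ ∧ dx^n`. -/
def vol : Crd n G [⋀^Fin n]→L[ℝ] ℝ := wedge dx

/-- The form `θ ∧ ω`. -/
def wedgeVol (θ : Crd n G →L[ℝ] ℝ) : Crd n G [⋀^Fin (n + 1)]→L[ℝ] ℝ :=
  wedge (Fin.cons θ dx)

/-- The form `θ ∧ ω_μ`, `ω_μ = ∂_μ ⌋ ω`. As `ω_μ` is `(-1)^(μ-1)` times the product of the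
remaining `dx`'s, this is `dx^1 ∧ ⋯ ∧ θ ∧ ⋯ ∧ dx^n` with `θ` in the place of `dx^μ`. -/
def wedgeVolAt (θ : Crd n G →L[ℝ] ℝ) (μ : Fin n) : Crd n G [⋀^Fin n]→L[ℝ] ℝ :=
  wedge (Function.update dx μ θ)

/-- The covector `dy^i`, on the coordinates `(x, y, ·)` of the jet manifold `J¹Y` or of the
Legendre manifold `Π`. -/
def dy {W : Type} [NormedAddCommGroup W] [NormedSpace ℝ W] (i : Fin m) :
    Crd n ((Fin m → ℝ) × W) →L[ℝ] ℝ :=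
  (ContinuousLinearMap.proj i).comp
    ((ContinuousLinearMap.fst ℝ (Fin m → ℝ) W).comp
      (ContinuousLinearMap.snd ℝ (Fin n → ℝ) ((Fin m → ℝ) × W)))

/-- The covector `dp^μ_i` on the coordinates of the Legendre manifold. -/
def dp (μ : Fin n) (i : Fin m) : Crd n (LegFib n m) →L[ℝ] ℝ :=
  (ContinuousLinearMap.proj i).comp
    ((ContinuousLinearMap.proj μ).comp
      ((ContinuousLinearMap.snd ℝ (Fin m → ℝ) (Fin n → Fin m → ℝ)).comp
        (ContinuousLinearMap.snd ℝ (Fin n → ℝ) (LegFib n m))))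

/-- The coordinate vector `∂^i_μ = ∂/∂p^μ_i` on the Legendre manifold, which is also the
coordinate vector `∂/∂y^i_μ` on `J¹Y`. -/
def vertVec (μ : Fin n) (i : Fin m) : Crd n (LegFib n m) :=
  (0, 0, Pi.single μ (Pi.single i 1))

/-! ### Jets in coordinates -/

/-- The projection `(x, g, g_λ) ↦ (x, g)` of a jet manifold. -/
def jetProj : Crd n (JetFib n G) →L[ℝ] Crd n G :=
  (ContinuousLinearMap.fst ℝ (Fin n → ℝ) (JetFib n G)).prod
    ((ContinuousLinearMap.fst ℝ G (Fin n → G)).comp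
      (ContinuousLinearMap.snd ℝ (Fin n → ℝ) (JetFib n G)))

/-- The vectors `∂_μ + u_μ` of a tangent-valued form `dx^μ ⊗ (∂_μ + u_μ)`. -/
def horizontalLift (u : Fin n → G) (μ : Fin n) : Crd n G := (e μ, u μ)

/-- The jet prolongation `J¹Φ` of a fibred morphism `Φ` over the identity of the base. -/
def jetProlongation (Φ : Crd n G → Crd n G') (z : Crd n (JetFib n G)) : Crd n (JetFib n G') :=
  (z.1, (Φ (jetProj z)).2, fun μ => (fderiv ℝ Φ (jetProj z) (horizontalLift z.2.2 μ)).2)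

/-- The contraction `γ ⌋ Ω` of a tangent-valued form `γ = dx^μ ⊗ γ_μ` with a `TX`-valued form
`Ω = Ω^μ ⊗ ∂_μ`, that is, the sum of the interior products `γ_μ ⌋ Ω^μ`. -/
def contract {E : Type*} [NormedAddCommGroup E] [NormedSpace ℝ E] {k : ℕ}
    (γ : Fin n → E) (Ω : Fin n → E [⋀^Fin (k + 1)]→L[ℝ] ℝ) : E [⋀^Fin k]→L[ℝ] ℝ :=
  ∑ μ, (Ω μ).curryLeft (γ μ)

/-! ### The Lagrangian side; `ℒ` is the coordinate expression of `L = ℒ ω` -/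

/-- `π^μ_i = ∂ℒ/∂y^i_μ`. -/
def mom (ℒ : Crd n (JetFib n (YFib m)) → ℝ) (μ : Fin n) (i : Fin m)
    (z : Crd n (JetFib n (YFib m))) : ℝ :=
  fderiv ℝ ℒ z (vertVec μ i)

/-- The Legendre morphism `(x, y, y_λ) ↦ (x, y, π^λ_i)`. -/
def legendre (ℒ : Crd n (JetFib n (YFib m)) → ℝ) (z : Crd n (JetFib n (YFib m))) :
    Crd n (LegFib n m) :=
  (z.1, z.2.1, fun μ i => mom ℒ μ i z)

/-- The Poincaré–Cartan form `Ξ_L = π^λ_i dy^i ∧ ω_λ - π^λ_i y^i_λ ω + ℒ ω`. -/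
def poincareCartan (ℒ : Crd n (JetFib n (YFib m)) → ℝ) (z : Crd n (JetFib n (YFib m))) :
    Crd n (JetFib n (YFib m)) [⋀^Fin n]→L[ℝ] ℝ :=
  (∑ μ, ∑ i, mom ℒ μ i z • wedgeVolAt (dy (W := Fin n → Fin m → ℝ) i) μ)
    - (∑ μ, ∑ i, mom ℒ μ i z * z.2.2 μ i) • vol (G := LegFib n m)
    + ℒ z • vol (G := LegFib n m)

/-- The components `Ω_L^μ = (∂_j π^μ_i dy^j + ∂^λ_j π^μ_i dy^j_λ) ∧ dy^i ∧ ω` of the Lagrangian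
multisymplectic form `Ω_L = Ω_L^μ ⊗ ∂_μ`. The first factor is the differential of `π^μ_i` without
its `dx` part. -/
def lagMultisymplectic (ℒ : Crd n (JetFib n (YFib m)) → ℝ) (z : Crd n (JetFib n (YFib m)))
    (μ : Fin n) : Crd n (JetFib n (YFib m)) [⋀^Fin (n + 2)]→L[ℝ] ℝ :=
  ∑ i, wedge (Fin.cons
    ((fderiv ℝ (mom ℒ μ i) z).comp
      ((ContinuousLinearMap.inr ℝ (Fin n → ℝ) (JetFib n (YFib m))).comp
        (ContinuousLinearMap.snd ℝ (Fin n → ℝ) (JetFib n (YFib m)))))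
    (Fin.cons (dy i) dx))

/-- The form `Λ_L = dΞ_L - λ ⌋ Ω_L` on `J¹J¹Y`, where `λ = dx^μ ⊗ (∂_μ + y^i_(μ) ∂_i +
y^i_{λμ} ∂^λ_i)` is the contact map of `J¹J¹Y` and the forms `Ξ_L`, `Ω_L` are pulled back to
`J¹J¹Y`. -/
def lagrangeForm (ℒ : Crd n (JetFib n (YFib m)) → ℝ)
    (z : Crd n (JetFib n (JetFib n (YFib m)))) :
    Crd n (JetFib n (JetFib n (YFib m))) [⋀^Fin (n + 1)]→L[ℝ] ℝ :=
  (extDeriv (poincareCartan ℒ) (jetProj z)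
    - contract (horizontalLift z.2.2) (lagMultisymplectic ℒ (jetProj z))).compContinuousLinearMap
      jetProj

/-! ### The Hamiltonian side -/

/-- The components `Ω^μ = dp^μ_i ∧ dy^i ∧ ω` of the multisymplectic form `Ω = Ω^μ ⊗ ∂_μ` on the
Legendre manifold. -/
def multisymplectic (μ : Fin n) : Crd n (LegFib n m) [⋀^Fin (n + 2)]→L[ℝ] ℝ :=
  ∑ i, wedge (Fin.cons (dp μ i) (Fin.cons (dy i) dx))

/-- The form `γ ⌋ Ω` for a jet field `γ = dx^μ ⊗ (∂_μ + γ_μ)` on the Legendre manifold, given by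
its components `γ_μ = (γ^i_(μ), γ^λ_{iμ})`. -/
def jetFieldContract (γ : Crd n (LegFib n m) → Fin n → LegFib n m) (q : Crd n (LegFib n m)) :
    Crd n (LegFib n m) [⋀^Fin (n + 1)]→L[ℝ] ℝ :=
  contract (horizontalLift (γ q)) multisymplectic

/-- `γ` is a Hamiltonian jet field on the open set `W`: it is smooth and `γ ⌋ Ω` is closed. -/
def IsHamiltonianJetField (γ : Crd n (LegFib n m) → Fin n → LegFib n m)
    (W : Set (Crd n (LegFib n m))) : Prop :=
  ContDiffOn ℝ ∞ γ W ∧ ∀ q ∈ W, extDeriv (jetFieldContract γ) q = 0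

/-- The Hamilton operator `ℰ_H = dH - λ ⌋ Ω`, as a form on `J¹Π`. Here `λ` is the contact map of
`J¹Π`, so that `λ ⌋ Ω = dp^λ_i ∧ dy^i ∧ ω_λ + p^λ_{iλ} dy^i ∧ ω - y^i_(λ) dp^λ_i ∧ ω`, and the
forms `dH`, `Ω` are pulled back from `Π` to `J¹Π`. -/
def hamiltonOperator (H : Crd n (LegFib n m) → Crd n (LegFib n m) [⋀^Fin n]→L[ℝ] ℝ)
    (w : Crd n (JetFib n (LegFib n m))) :
    Crd n (JetFib n (LegFib n m)) [⋀^Fin (n + 1)]→L[ℝ] ℝ :=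
  (extDeriv H (jetProj w)
    - contract (horizontalLift w.2.2) multisymplectic).compContinuousLinearMap jetProj

/-- The function `∂^i_μ ℋ = ∂ℋ/∂p^μ_i` of a Hamiltonian form `H`, read off as
`-dH(∂^i_μ, ∂_1, …, ∂_n)`. It depends on `H` modulo closed forms only;
see `momentumCoeff_eq` for `H = p^λ_i dy^i ∧ ω_λ - ℋ ω`. It is also the coefficient `γ^i_(μ)` of
every Hamiltonian jet field for `H`. -/
def momentumCoeff (H : Crd n (LegFib n m) → Crd n (LegFib n m) [⋀^Fin n]→L[ℝ] ℝ)
    (q : Crd n (LegFib n m)) (μ : Fin n) (i : Fin m) : ℝ :=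
  -(extDeriv H q (Fin.cons (vertVec μ i) fun ν => (e ν, 0)))

/-- The momentum morphism `Ĥ : Π → J¹Y` of a Hamiltonian form, `y^i_λ ∘ Ĥ = ∂^i_λ ℋ`. -/
def momentumMorphism (H : Crd n (LegFib n m) → Crd n (LegFib n m) [⋀^Fin n]→L[ℝ] ℝ)
    (q : Crd n (LegFib n m)) : Crd n (JetFib n (YFib m)) :=
  (q.1, q.2.1, momentumCoeff H q)

/-- The Hamiltonian form `p^λ_i dy^i ∧ ω_λ - ℋ ω`. -/
def hamForm (ℋ : Crd n (LegFib n m) → ℝ) (q : Crd n (LegFib n m)) :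
    Crd n (LegFib n m) [⋀^Fin n]→L[ℝ] ℝ :=
  (∑ μ, ∑ i, q.2.2 μ i • wedgeVolAt (dy (W := Fin n → Fin m → ℝ) i) μ)
    - ℋ q • vol (G := LegFib n m)

theorem wedge_apply {E : Type*} [AddCommGroup E] [Module ℝ E] [TopologicalSpace E] {k : ℕ}
    (θ : Fin k → E →L[ℝ] ℝ) (v : Fin k → E) :
    wedge θ v = Matrix.det (Matrix.of fun j i => θ i (v j)) := rfl

/-- For `H = p^λ_i dy^i ∧ ω_λ - ℋ ω`, `momentumCoeff` is the partial derivative of `ℋ`. -/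
theorem momentumCoeff_eq (ℋ : Crd n (LegFib n m) → ℝ) (q : Crd n (LegFib n m))
    (hℋ : DifferentiableAt ℝ ℋ q) (μ : Fin n) (i : Fin m) :
    momentumCoeff (hamForm ℋ) q μ i = fderiv ℝ ℋ q (vertVec μ i) := by
  have hd : HasFDerivAt (hamForm ℋ)
      ((∑ μ, ∑ i, (dp μ i).smulRight (wedgeVolAt (dy (W := Fin n → Fin m → ℝ) i) μ))
        - (fderiv ℝ ℋ q).smulRight (vol (G := LegFib n m))) q := by
    refine HasFDerivAt.sub (HasFDerivAt.fun_sum fun μ _ => HasFDerivAt.fun_sum fun i _ => ?_) ?_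
    · exact (dp (n := n) (m := m) μ i).hasFDerivAt.smul_const
        (wedgeVolAt (dy (W := Fin n → Fin m → ℝ) i) μ)
    · exact hℋ.hasFDerivAt.smul_const (vol (G := LegFib n m))
  have hvol : vol (n := n) (G := LegFib n m) (fun ν => (e ν, 0)) = 1 := by
    have : (Matrix.of fun j i => dx (n := n) (G := LegFib n m) i (e j, 0)) = 1 := by
      ext a b
      simp [dx, e, Matrix.one_apply, Pi.single_apply, eq_comm]
    rw [vol, wedge_apply, this, Matrix.det_one]
  have hw : ∀ (ν : Fin n) (j : Fin m),
      wedgeVolAt (dy (W := Fin n → Fin m → ℝ) j) ν (fun ν => (e ν, 0)) = 0 := by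
    intro ν j
    rw [wedgeVolAt, wedge_apply]
    exact Matrix.det_eq_zero_of_column_eq_zero ν fun a => by simp [dy]
  rw [momentumCoeff, extDeriv, hd.fderiv,
    ContinuousAlternatingMap.alternatizeUncurryFin_apply, Fin.sum_univ_succ]
  have hv : ∀ k : Fin n, vol (n := n) (G := LegFib n m) (k.succ.removeNth
      (Fin.cons (vertVec μ i) (fun ν => (e ν, 0)) : Fin (n + 1) → Crd n (LegFib n m))) = 0 := by
    intro k
    rw [vol, wedge_apply]
    refine Matrix.det_eq_zero_of_row_eq_zero ⟨0, k.pos⟩ fun a => ?_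
    have h0 : k.succ.succAbove ⟨0, k.pos⟩ = 0 := by
      rw [Fin.succAbove_of_castSucc_lt _ _ (by simp [Fin.lt_def])]
      rfl
    simp [Fin.removeNth, dx, vertVec, h0]
  simp [hvol, hw, hv, dp]

/-- The Hamiltonian form `H_Φ = p^λ_i dy^i ∧ ω_λ - p^λ_i Φ^i_λ ω` of a momentum morphism `Φ`. -/
def momentumForm (Φ : Crd n (LegFib n m) → Crd n (JetFib n (YFib m))) :
    Crd n (LegFib n m) → Crd n (LegFib n m) [⋀^Fin n]→L[ℝ] ℝ :=
  hamForm fun q => ∑ μ, ∑ i, q.2.2 μ i * (Φ q).2.2 μ i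

end Coordinates

/-! ## Immersed submanifolds -/

/-- `S` is an immersed submanifold: the image of an injective immersion of a second countable
Hausdorff manifold. Embedded submanifolds are the case where the immersion is a homeomorphism
onto `S`. -/
def IsSubmanifold {E : Type} [NormedAddCommGroup E] [NormedSpace ℝ E] (S : Set E) : Prop :=
  ∃ (k : ℕ) (N : Type) (_ : TopologicalSpace N) (_ : ChartedSpace (EuclideanSpace ℝ (Fin k)) N)
    (_ : IsManifold (𝓡 k) ∞ N) (_ : T2Space N) (_ : SecondCountableTopology N) (f : N → E),
    Manifold.IsImmersion (𝓡 k) 𝓘(ℝ, E) ∞ f ∧ Function.Injective f ∧ range f = S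

/-! ## Fibred manifolds, jets and the Legendre manifold -/

section Manifolds

variable (n m : ℕ) {X Y : Type*}
  [TopologicalSpace X] [ChartedSpace (EuclideanSpace ℝ (Fin n)) X]
  [TopologicalSpace Y] [ChartedSpace (EuclideanSpace ℝ (Fin (n + m))) Y]

/-- A fibred manifold: a surjective submersion `π : Y → X`, `dim X = n`, `dim Y = n + m`. -/
class IsFibredManifold (π : Y → X) : Prop where
  surjective : Function.Surjective π
  submersion : Manifold.IsSubmersion (𝓡 (n + m)) (𝓡 n) ∞ π

/-- The first order jet manifold `J¹Y`, as a set: the jet `j¹_x s` of a section `s` with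
`s x = y` is the point `y` with the derivative of `s` at `x = π y`, which can be any linear right
inverse of the derivative of `π` at `y`. -/
structure Jet (π : Y → X) where
  /-- the point `y` -/
  pt : Y
  /-- the derivative of the section -/
  lift : TangentSpace (𝓡 n) (π pt) →L[ℝ] TangentSpace (𝓡 (n + m)) pt
  mfderiv_lift : (mfderiv (𝓡 (n + m)) (𝓡 n) π pt).comp lift =
    ContinuousLinearMap.id ℝ (TangentSpace (𝓡 n) (π pt))

/-- The fibre at `y` of the Legendre manifold `Π = ⋀ⁿT*X ⊗ TX ⊗ V*Y`. -/
abbrev LegendreFibre (π : Y → X) (y : Y) : Type :=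
  (TangentSpace (𝓡 n) (π y) [⋀^Fin n]→L[ℝ] ℝ) ⊗[ℝ] (TangentSpace (𝓡 n) (π y) ⊗[ℝ]
    Module.Dual ℝ (LinearMap.ker (mfderiv (𝓡 (n + m)) (𝓡 n) π y).toLinearMap))

/-- The Legendre manifold, as a set. -/
abbrev LegendreSpace (π : Y → X) : Type _ := Σ y : Y, LegendreFibre n m π y

/-- A fibred chart `(x^λ, y^i)` of `π : Y → X`, together with the chart `(x^λ)` of `X`. -/
structure FibredChart (π : Y → X) where
  /-- the chart of `Y` -/
  chartY : OpenPartialHomeomorph Y (Crd n (YFib m))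
  /-- the chart of `X` -/
  chartX : OpenPartialHomeomorph X (Fin n → ℝ)
  smoothY : ContMDiffOn (𝓡 (n + m)) 𝓘(ℝ, Crd n (YFib m)) ∞ chartY chartY.source
  smoothY_symm : ContMDiffOn 𝓘(ℝ, Crd n (YFib m)) (𝓡 (n + m)) ∞ chartY.symm chartY.target
  smoothX : ContMDiffOn (𝓡 n) 𝓘(ℝ, Fin n → ℝ) ∞ chartX chartX.source
  smoothX_symm : ContMDiffOn 𝓘(ℝ, Fin n → ℝ) (𝓡 n) ∞ chartX.symm chartX.target
  mapsTo : ∀ y ∈ chartY.source, π y ∈ chartX.source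
  fst_chartY : ∀ y ∈ chartY.source, (chartY y).1 = chartX (π y)

variable {n m} {π : Y → X}

namespace FibredChart

/-- The covectors `dx^λ`, jointly. -/
def dX (c : FibredChart n m π) (x : X) : TangentSpace (𝓡 n) x →L[ℝ] (Fin n → ℝ) :=
  mfderiv (𝓡 n) 𝓘(ℝ, Fin n → ℝ) c.chartX x

/-- The coordinate vectors `∂_λ` of `X`. -/
def baseVec (c : FibredChart n m π) (x : X) (μ : Fin n) : TangentSpace (𝓡 n) x :=
  mfderiv 𝓘(ℝ, Fin n → ℝ) (𝓡 n) c.chartX.symm (c.chartX x) (e μ)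

/-- The covector `dy^i`, restricted to vertical vectors. -/
def dyVert (c : FibredChart n m π) (y : Y) (i : Fin m) :
    Module.Dual ℝ (LinearMap.ker (mfderiv (𝓡 (n + m)) (𝓡 n) π y).toLinearMap) :=
  (((ContinuousLinearMap.proj i).comp
      ((ContinuousLinearMap.snd ℝ (Fin n → ℝ) (YFib m)).comp
        (mfderiv (𝓡 (n + m)) 𝓘(ℝ, Crd n (YFib m)) c.chartY y :
          TangentSpace (𝓡 (n + m)) y →L[ℝ] Crd n (YFib m)))).toLinearMap).domRestrict _

/-- The form `ω` at a point of `X`. -/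
def volX (c : FibredChart n m π) (x : X) : TangentSpace (𝓡 n) x [⋀^Fin n]→L[ℝ] ℝ :=
  wedge fun μ => (ContinuousLinearMap.proj μ).comp (c.dX x)

/-- The domain of the adapted coordinates `(x, y, …)` of `J¹Y` or `Π` over the chart `c`. -/
def dom {W : Type} (c : FibredChart n m π) : Set (Crd n ((Fin m → ℝ) × W)) :=
  {z | (z.1, z.2.1) ∈ c.chartY.target}

/-- The point of the Legendre manifold with adapted coordinates `(x^λ, y^i, p^λ_i)`:
`p^λ_i ω ⊗ ∂_λ ⊗ dy^i`. -/
def legendrePoint (c : FibredChart n m π) (q : Crd n (LegFib n m)) : LegendreSpace n m π :=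
  ⟨c.chartY.symm (q.1, q.2.1),
    ∑ μ, ∑ i, q.2.2 μ i •
      (c.volX _ ⊗ₜ[ℝ] (c.baseVec _ μ ⊗ₜ[ℝ] c.dyVert (c.chartY.symm (q.1, q.2.1)) i))⟩

/-- The linear map `dx^λ ⊗ (∂_λ + y^i_λ ∂_i)` of the jet with adapted coordinates
`(x^λ, y^i, y^i_λ)`. -/
def jetLift (c : FibredChart n m π) (z : Crd n (JetFib n (YFib m))) :
    TangentSpace (𝓡 n) (π (c.chartY.symm (z.1, z.2.1))) →L[ℝ]
      TangentSpace (𝓡 (n + m)) (c.chartY.symm (z.1, z.2.1)) :=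
  (mfderiv 𝓘(ℝ, Crd n (YFib m)) (𝓡 (n + m)) c.chartY.symm (z.1, z.2.1) :
      Crd n (YFib m) →L[ℝ] TangentSpace (𝓡 (n + m)) (c.chartY.symm (z.1, z.2.1))).comp
    (((ContinuousLinearMap.id ℝ (Fin n → ℝ)).prod
      (∑ μ, (ContinuousLinearMap.proj (R := ℝ) (φ := fun _ : Fin n => ℝ) μ).smulRight
        (z.2.2 μ))).comp (c.dX (π (c.chartY.symm (z.1, z.2.1)))))

theorem mfderiv_comp_jetLift [IsFibredManifold n m π] (c : FibredChart n m π)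
    {z : Crd n (JetFib n (YFib m))} (hz : z ∈ c.dom) :
    (mfderiv (𝓡 (n + m)) (𝓡 n) π (c.chartY.symm (z.1, z.2.1))).comp (c.jetLift z) =
      ContinuousLinearMap.id ℝ (TangentSpace (𝓡 n) (π (c.chartY.symm (z.1, z.2.1)))) := by
  have hz' : (z.1, z.2.1) ∈ c.chartY.target := hz
  have hs : c.chartY.symm (z.1, z.2.1) ∈ c.chartY.source := c.chartY.map_target hz'
  have hx : π (c.chartY.symm (z.1, z.2.1)) ∈ c.chartX.source := c.mapsTo _ hs
  have hx1 : c.chartX (π (c.chartY.symm (z.1, z.2.1))) = z.1 := by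
    rw [← c.fst_chartY _ hs, c.chartY.right_inv hz']
  have hx2 : z.1 ∈ c.chartX.target := hx1 ▸ c.chartX.map_source hx
  have hπ : MDifferentiableAt (𝓡 (n + m)) (𝓡 n) π (c.chartY.symm (z.1, z.2.1)) :=
    ((IsFibredManifold.submersion (n := n) (m := m) (π := π)).contMDiff _).mdifferentiableAt
      (by simp)
  have hY : MDifferentiableAt 𝓘(ℝ, Crd n (YFib m)) (𝓡 (n + m)) c.chartY.symm (z.1, z.2.1) :=
    ((c.smoothY_symm _ hz').contMDiffAt
      (c.chartY.open_target.mem_nhds hz')).mdifferentiableAt (by simp)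
  have hX : MDifferentiableAt (𝓡 n) 𝓘(ℝ, Fin n → ℝ) c.chartX
      (π (c.chartY.symm (z.1, z.2.1))) :=
    ((c.smoothX _ hx).contMDiffAt (c.chartX.open_source.mem_nhds hx)).mdifferentiableAt (by simp)
  have hXs : MDifferentiableAt 𝓘(ℝ, Fin n → ℝ) (𝓡 n) c.chartX.symm z.1 :=
    ((c.smoothX_symm _ hx2).contMDiffAt
      (c.chartX.open_target.mem_nhds hx2)).mdifferentiableAt (by simp)
  have hfst : HasMFDerivAt 𝓘(ℝ, Crd n (YFib m)) 𝓘(ℝ, Fin n → ℝ)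
      (Prod.fst : Crd n (YFib m) → Fin n → ℝ) (z.1, z.2.1)
      (ContinuousLinearMap.fst ℝ (Fin n → ℝ) (YFib m)) :=
    hasFDerivAt_fst.hasMFDerivAt
  have h1 : HasMFDerivAt 𝓘(ℝ, Crd n (YFib m)) (𝓡 n) (π ∘ c.chartY.symm) (z.1, z.2.1) _ :=
    hπ.hasMFDerivAt.comp _ hY.hasMFDerivAt
  have h2 : HasMFDerivAt 𝓘(ℝ, Crd n (YFib m)) (𝓡 n)
      (c.chartX.symm ∘ (Prod.fst : Crd n (YFib m) → Fin n → ℝ)) (z.1, z.2.1) _ :=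
    HasMFDerivAt.comp (z.1, z.2.1) (g := c.chartX.symm) hXs.hasMFDerivAt hfst
  have heq : (π ∘ c.chartY.symm) =ᶠ[nhds (z.1, z.2.1)]
      (c.chartX.symm ∘ (Prod.fst : Crd n (YFib m) → Fin n → ℝ)) := by
    filter_upwards [c.chartY.open_target.mem_nhds hz'] with w hw
    have hws := c.chartY.map_target hw
    have := c.fst_chartY _ hws
    rw [c.chartY.right_inv hw] at this
    simp only [Function.comp_apply, this]
    exact (c.chartX.left_inv (c.mapsTo _ hws)).symm
  have h12 := hasMFDerivAt_unique h1 (h2.congr_of_eventuallyEq heq)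
  have h3 : HasMFDerivAt (𝓡 n) (𝓡 n) (c.chartX.symm ∘ c.chartX)
      (π (c.chartY.symm (z.1, z.2.1))) _ :=
    HasMFDerivAt.comp _ (hx1 ▸ hXs.hasMFDerivAt) hX.hasMFDerivAt
  have h4 : HasMFDerivAt (𝓡 n) (𝓡 n) (c.chartX.symm ∘ c.chartX)
      (π (c.chartY.symm (z.1, z.2.1)))
      (ContinuousLinearMap.id ℝ (TangentSpace (𝓡 n) (π (c.chartY.symm (z.1, z.2.1))))) := by
    refine (hasMFDerivAt_id _).congr_of_eventuallyEq ?_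
    filter_upwards [c.chartX.open_source.mem_nhds hx] with w hw
    exact c.chartX.left_inv hw
  have h34 := hasMFDerivAt_unique h3 h4
  ext v
  have hu : ((ContinuousLinearMap.id ℝ (Fin n → ℝ)).prod
      (∑ μ, (ContinuousLinearMap.proj (R := ℝ) (φ := fun _ : Fin n => ℝ) μ).smulRight
        (z.2.2 μ))) (c.dX (π (c.chartY.symm (z.1, z.2.1))) v) =
      ((c.dX (π (c.chartY.symm (z.1, z.2.1))) v,
        ∑ μ, (c.dX (π (c.chartY.symm (z.1, z.2.1))) v) μ • z.2.2 μ) : Crd n (YFib m)) := by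
    simp
  have a := congrArg (fun A => A ((c.dX (π (c.chartY.symm (z.1, z.2.1))) v,
    ∑ μ, (c.dX (π (c.chartY.symm (z.1, z.2.1))) v) μ • z.2.2 μ) : Crd n (YFib m))) h12
  have b := congrArg (fun A => A v) h34
  have d : ∀ w : Fin n → ℝ,
      (show EuclideanSpace ℝ (Fin n) from mfderiv 𝓘(ℝ, Fin n → ℝ) (𝓡 n) c.chartX.symm z.1 w) =
      (show EuclideanSpace ℝ (Fin n) from mfderiv 𝓘(ℝ, Fin n → ℝ) (𝓡 n) c.chartX.symm
        (c.chartX (π (c.chartY.symm (z.1, z.2.1)))) w) := by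
    intro w
    rw [hx1]
  exact ((congrArg (fun w => mfderiv (𝓡 (n + m)) (𝓡 n) π (c.chartY.symm (z.1, z.2.1))
    (mfderiv 𝓘(ℝ, Crd n (YFib m)) (𝓡 (n + m)) c.chartY.symm (z.1, z.2.1) w)) hu).trans
    a).trans ((d _).trans b)

/-- The jet with adapted coordinates `(x^λ, y^i, y^i_λ)`. -/
def jet [IsFibredManifold n m π] (c : FibredChart n m π) {z : Crd n (JetFib n (YFib m))}
    (hz : z ∈ c.dom) : Jet n m π :=
  ⟨c.chartY.symm (z.1, z.2.1), c.jetLift z, c.mfderiv_comp_jetLift hz⟩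

open scoped Classical in
/-- The coordinate expression `ℒ` of a horizontal density `L = ℒ ω` on `J¹Y` (zero outside the
domain of the chart). -/
def density [IsFibredManifold n m π] (c : FibredChart n m π)
    (L : (j : Jet n m π) → TangentSpace (𝓡 n) (π j.pt) [⋀^Fin n]→L[ℝ] ℝ)
    (z : Crd n (JetFib n (YFib m))) : ℝ :=
  if hz : z ∈ c.dom then L (c.jet hz) (c.baseVec _) else 0

end FibredChart

variable (n m π)

/-- A first order Lagrangian density: a smooth horizontal density `L : J¹Y → ⋀ⁿT*X` over `X`. -/
structure LagrangianDensity [IsFibredManifold n m π] where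
  /-- the density -/
  toFun : (j : Jet n m π) → TangentSpace (𝓡 n) (π j.pt) [⋀^Fin n]→L[ℝ] ℝ
  smooth : ∀ c : FibredChart n m π, ContDiffOn ℝ ∞ (c.density toFun) c.dom

/-- A smooth exterior form of degree `k` on the Legendre manifold: smooth forms on the domains of
all adapted charts, which are pulled back to one another by the changes `T` of adapted
coordinates. -/
structure LegendreForm (k : ℕ) where
  /-- the coordinate expression; its values outside the domain of the chart are irrelevant -/
  loc : FibredChart n m π → Crd n (LegFib n m) → Crd n (LegFib n m) [⋀^Fin k]→L[ℝ] ℝ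
  smooth : ∀ c, ContDiffOn ℝ ∞ (loc c) c.dom
  compat : ∀ (c c' : FibredChart n m π) (W : Set (Crd n (LegFib n m)))
    (T : Crd n (LegFib n m) → Crd n (LegFib n m)), IsOpen W → W ⊆ c.dom → MapsTo T W c'.dom →
    ContDiffOn ℝ ∞ T W → (∀ q ∈ W, c'.legendrePoint (T q) = c.legendrePoint q) →
    ∀ q ∈ W, loc c q = (loc c' (T q)).compContinuousLinearMap (fderiv ℝ T q)

variable {n m π}

/-- The coordinate expression `ℒ` of a Lagrangian density. -/
def LagrangianDensity.loc [IsFibredManifold n m π] (L : LagrangianDensity n m π)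
    (c : FibredChart n m π) : Crd n (JetFib n (YFib m)) → ℝ :=
  c.density L.toFun

/-- `L` is semiregular: the preimage of every point of `Q = L̂(J¹Y)` under the Legendre morphism
`L̂` is a connected submanifold of `J¹Y`. As `L̂` is a morphism over `Y`, such a preimage lies in
the domain of every adapted chart around one of its points. -/
def LagrangianDensity.IsSemiregular [IsFibredManifold n m π] (L : LagrangianDensity n m π) :
    Prop :=
  ∀ (c : FibredChart n m π), ∀ q ∈ legendre (L.loc c) '' c.dom,
    IsConnected (c.dom ∩ legendre (L.loc c) ⁻¹' {q}) ∧
      IsSubmanifold (c.dom ∩ legendre (L.loc c) ⁻¹' {q})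

/-- `H` is a Hamiltonian form: near each point of the Legendre manifold there is a Hamiltonian jet
field `γ` with `γ ⌋ Ω = dH`. -/
def LegendreForm.IsHamiltonian (H : LegendreForm n m π n) : Prop :=
  ∀ (c : FibredChart n m π), ∀ q ∈ c.dom (W := Fin n → Fin m → ℝ),
    ∃ (W : Set (Crd n (LegFib n m))) (γ : Crd n (LegFib n m) → Fin n → LegFib n m),
      IsOpen W ∧ q ∈ W ∧ W ⊆ c.dom ∧ IsHamiltonianJetField γ W ∧
        ∀ w ∈ W, jetFieldContract γ w = extDeriv (H.loc c) w

/-- The Hamiltonian form `H` is associated with `L`: `L̂ ∘ Ĥ` is the identity on `Q = L̂(J¹Y)`, and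
`H = H_Ĥ + L ∘ Ĥ`, Hamiltonian forms being considered modulo closed forms. -/
structure LegendreForm.IsAssociated [IsFibredManifold n m π] (H : LegendreForm n m π n)
    (L : LagrangianDensity n m π) : Prop where
  legendre_momentum : ∀ (c : FibredChart n m π), ∀ q ∈ legendre (L.loc c) '' c.dom,
    legendre (L.loc c) (momentumMorphism (H.loc c) q) = q
  eq_mod_closed : ∀ (c : FibredChart n m π), ∀ q ∈ c.dom (W := Fin n → Fin m → ℝ),
    extDeriv (fun w => H.loc c w - (momentumForm (momentumMorphism (H.loc c)) w +
      L.loc c (momentumMorphism (H.loc c) w) • vol)) q = 0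

end Manifolds

end Multimomentum

end

/-! Let `E = π^λ_i y^i_λ - ℒ` be the energy. Modulo closed forms, an associated `H` is `p^λ_i dy^i ∧
ω_λ - ℋ ω` with `ℋ = p^λ_i Ĥ^i_λ - ℒ ∘ Ĥ`, and everything rests on the identity `ℋ ∘ L̂ = E`.

Semiregularity gives this identity. We have `dE = y^i_λ dπ^λ_i + π^λ_i dy^i_λ - dℒ`. A vector killed
by the differential of `L̂` has no `x` or `y` component and satisfies `dπ^λ_i = 0`; on it the last
two terms cancel, because `π^λ_i = ∂ℒ/∂y^i_λ`. Hence `E` is constant on the connected fibres of `L̂`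
(`IsSubmanifold.eq_of_ker_le`, `fderiv_energy_eq_zero`). As `L̂ ∘ Ĥ` is the identity on `Q`, the
points `w` and `Ĥ (L̂ w)` share a fibre, so `ℋ (L̂ w) = E (Ĥ (L̂ w)) = E w`.

It follows that `L̂` pulls `p^λ_i dy^i ∧ ω_λ - ℋ ω` back to `Ξ_L`, hence `dH` to `dΞ_L`. It also
pulls `Ω` back to `Ω_L` (`multisymplectic_compContinuousLinearMap`), and its differential carries
the contact vectors of `J¹J¹Y` to those of `J¹Π`, by the definition of `J¹L̂`. So the contracted
terms correspond as well; `lagrangeForm_eq_of_energy` assembles the two parts. -/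

noncomputable section

namespace Multimomentum

/-! ### Functions on connected immersed submanifolds -/

/-- If the differential of `ψ` vanishes on the kernel of the differential of a map which is constant
on a connected immersed submanifold `S`, then `ψ` is constant on `S`. The connectedness is that of
the subspace topology: `ψ` takes countably many values on `S`, as `S` has a second countable
manifold topology. -/
theorem IsSubmanifold.eq_of_ker_le {E F : Type} [NormedAddCommGroup E] [NormedSpace ℝ E]
    [NormedAddCommGroup F] [NormedSpace ℝ F] {S : Set E} (hS : IsSubmanifold S)
    (hc : IsPreconnected S) {ψ : E → ℝ} {P : E → F} {q : F}
    (hψ : ∀ x ∈ S, DifferentiableAt ℝ ψ x) (hP : ∀ x ∈ S, DifferentiableAt ℝ P x)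
    (hPq : ∀ x ∈ S, P x = q)
    (hker : ∀ x ∈ S, ∀ u, fderiv ℝ P x u = 0 → fderiv ℝ ψ x u = 0)
    {x y : E} (hx : x ∈ S) (hy : y ∈ S) : ψ x = ψ y := by
  obtain ⟨k, N, _, _, _, _, _, f, hf, -, rfl⟩ := hS
  -- `ψ ∘ f` is locally constant: `P ∘ f` is constant, so in a chart the derivative of `f` takes
  -- values in the kernel of that of `P`, hence in the kernel of that of `ψ`.
  have hloc : ∀ a : N, {b | ψ (f b) = ψ (f a)} ∈ nhds a := by
    intro a
    set φ := extChartAt (𝓡 k) a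
    have hopen : IsOpen φ.target := isOpen_extChartAt_target a
    have hg : DifferentiableOn ℝ (f ∘ φ.symm) φ.target := by
      have h := hf.contMDiff.comp_contMDiffOn (contMDiffOn_extChartAt_symm (n := ∞) a)
      exact h.contDiffOn.differentiableOn (by simp)
    obtain ⟨r, hr, hball⟩ := Metric.isOpen_iff.1 hopen _ (mem_extChartAt_target a)
    have hda : ∀ t ∈ φ.target, DifferentiableAt ℝ (f ∘ φ.symm) t := fun t ht =>
      (hg t ht).differentiableAt (hopen.mem_nhds ht)
    have hconst : ∀ t ∈ Metric.ball (φ a) r, ψ (f (φ.symm t)) = ψ (f a) := by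
      intro t ht
      have h := Metric.isOpen_ball.is_const_of_fderiv_eq_zero (𝕜 := ℝ)
        (f := ψ ∘ (f ∘ φ.symm)) (convex_ball (φ a) r).isPreconnected
        (fun s hs => ((hψ _ (mem_range_self _)).comp s (hda s (hball hs))).differentiableWithinAt)
        (fun s hs => ?_) ht (Metric.mem_ball_self hr)
      · simpa [φ] using h
      · have hs' := hda s (hball hs)
        have hPs : fderiv ℝ (P ∘ (f ∘ φ.symm)) s = 0 := by
          have : P ∘ (f ∘ φ.symm) = fun _ => q := funext fun _ => hPq _ (mem_range_self _)
          rw [this]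
          simp
        rw [fderiv_comp s (hP _ (mem_range_self _)) hs'] at hPs
        rw [fderiv_comp s (hψ _ (mem_range_self _)) hs']
        ext u
        exact hker _ (mem_range_self _) _ (congrArg (fun A => A u) hPs)
    have hn : φ.source ∩ φ ⁻¹' Metric.ball (φ a) r ∈ nhds a :=
      Filter.inter_mem (extChartAt_source_mem_nhds a)
        ((continuousAt_extChartAt a).preimage_mem_nhds (Metric.ball_mem_nhds _ hr))
    filter_upwards [hn] with b hb
    rw [← hconst _ hb.2, φ.left_inv hb.1]
  -- Local constancy alone is not enough: the topology of `N` may be finer than that of its image,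
  -- and `N` may be disconnected. By the Lindelöf property `ψ` takes only countably many values, and
  -- a countable subset of `ℝ` is totally disconnected.
  obtain ⟨s, hs, hcover⟩ := TopologicalSpace.countable_cover_nhds hloc
  have hcount : (ψ '' range f).Countable := by
    refine (hs.image (ψ ∘ f)).mono ?_
    rintro _ ⟨_, ⟨b, rfl⟩, rfl⟩
    obtain ⟨a, ha, hb⟩ := mem_iUnion₂.1 (hcover ▸ mem_univ b)
    exact ⟨a, ha, hb.symm⟩
  exact hcount.isTotallyDisconnected _ subset_rfl
    (hc.image ψ fun z hz => (hψ z hz).continuousAt.continuousWithinAt)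
    (mem_image_of_mem ψ hx) (mem_image_of_mem ψ hy)

/-! ### Exterior products -/

section Wedge

variable {E E' : Type*} [NormedAddCommGroup E] [NormedSpace ℝ E] [NormedAddCommGroup E']
  [NormedSpace ℝ E']

theorem wedge_compContinuousLinearMap {k : ℕ} (θ : Fin k → E →L[ℝ] ℝ) (A : E' →L[ℝ] E) :
    (wedge θ).compContinuousLinearMap A = wedge fun i => (θ i).comp A := rfl

/-- A repeated covector kills an exterior product. This serves to discard the `dx` part of `dπ^λ_i`
in front of `dy^i ∧ ω`; there `β` is `dx`, and `σ` locates it among the remaining factors. -/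
theorem wedge_cons_add_sum {k l : ℕ} (α : E →L[ℝ] ℝ) (β : Fin l → E →L[ℝ] ℝ)
    (θ : Fin k → E →L[ℝ] ℝ) (a : Fin l → ℝ) (σ : Fin l → Fin k) (hβ : ∀ j, β j = θ (σ j)) :
    wedge (Fin.cons (α + ∑ j, a j • β j) θ : Fin (k + 1) → E →L[ℝ] ℝ) =
      wedge (Fin.cons α θ) := by
  ext v
  -- After transposition each covector is a row of the determinant, so dependence on the first
  -- covector becomes the linear map `curryLeft`.
  have key : ∀ α : E →L[ℝ] ℝ, wedge (Fin.cons α θ : Fin (k + 1) → E →L[ℝ] ℝ) v =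
      (Matrix.detRowAlternating (n := Fin (k + 1)) (R := ℝ)).curryLeft (fun j => α (v j))
        (fun i j => θ i (v j)) := by
    intro α
    rw [wedge_apply, ← Matrix.det_transpose]
    change Matrix.det _ = Matrix.det _
    congr 1
    ext i j
    refine Fin.cases ?_ (fun i => ?_) i <;> simp
  have hsum : (fun j => (α + ∑ l, a l • β l) (v j)) =
      (fun j => α (v j)) + ∑ l, a l • (fun j => θ (σ l) (v j)) := by
    ext j
    simp [hβ]
  have hzero : ∀ (A : (Fin (k + 1) → ℝ) [⋀^Fin k]→ₗ[ℝ] ℝ) (B : Fin l → (Fin (k + 1) → ℝ) [⋀^Fin k]→ₗ[ℝ] ℝ)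
      (x : Fin k → Fin (k + 1) → ℝ),
      (∀ j, B j x = 0) → (A + ∑ j, B j) x = A x := by
    intro A B x hB
    rw [AlternatingMap.add_apply, add_eq_left]
    exact Finset.sum_induction B (fun f => f x = 0)
      (fun f g hf hg => by rw [AlternatingMap.add_apply, hf, hg, add_zero]) rfl fun j _ => hB j
  rw [key, key, hsum, map_add, map_sum]
  refine hzero _ _ _ fun l => ?_
  rw [map_smul, AlternatingMap.smul_apply, AlternatingMap.curryLeft_apply_apply,
    AlternatingMap.map_eq_zero_of_eq (i := 0) (j := (σ l).succ) _ _ (by simp)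
      (Fin.succ_ne_zero _).symm, smul_zero]

theorem curryLeft_compContinuousLinearMap {k : ℕ} (η : E [⋀^Fin (k + 1)]→L[ℝ] ℝ)
    (A : E' →L[ℝ] E) (u : E') :
    (η.compContinuousLinearMap A).curryLeft u =
      (η.curryLeft (A u)).compContinuousLinearMap A := by
  ext v
  simp only [ContinuousAlternatingMap.curryLeft_apply_apply,
    ContinuousAlternatingMap.compContinuousLinearMap_apply]
  congr 1
  ext i
  refine Fin.cases ?_ (fun i => ?_) i <;> simp

theorem sum_compContinuousLinearMap {ι : Type*} (s : Finset ι) {k : ℕ}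
    (η : ι → E [⋀^Fin k]→L[ℝ] ℝ) (A : E' →L[ℝ] E) :
    (∑ j ∈ s, η j).compContinuousLinearMap A = ∑ j ∈ s, (η j).compContinuousLinearMap A := by
  ext v
  simp

theorem sub_compContinuousLinearMap {k : ℕ} (η ζ : E [⋀^Fin k]→L[ℝ] ℝ) (A : E' →L[ℝ] E) :
    (η - ζ).compContinuousLinearMap A =
      η.compContinuousLinearMap A - ζ.compContinuousLinearMap A := rfl

theorem smul_compContinuousLinearMap {k : ℕ} (a : ℝ) (η : E [⋀^Fin k]→L[ℝ] ℝ) (A : E' →L[ℝ] E) :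
    (a • η).compContinuousLinearMap A = a • η.compContinuousLinearMap A := rfl

/-- Naturality of the interior product, for vectors related by `A`. It is meant for `A` the
differential of the Legendre morphism and `γ` the contact vectors. -/
theorem contract_compContinuousLinearMap {n k : ℕ} (γ : Fin n → E')
    (Ω : Fin n → E [⋀^Fin (k + 1)]→L[ℝ] ℝ) (A : E' →L[ℝ] E) :
    (contract (fun μ => A (γ μ)) Ω).compContinuousLinearMap A =
      contract γ fun μ => (Ω μ).compContinuousLinearMap A := by
  simp only [contract, sum_compContinuousLinearMap, curryLeft_compContinuousLinearMap]

end Wedge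

/-! ### The Legendre morphism -/

section Legendre

variable {n m : ℕ} {ℒ : Crd n (JetFib n (YFib m)) → ℝ} {D : Set (Crd n (JetFib n (YFib m)))}
  {w : Crd n (JetFib n (YFib m))}

theorem contDiffOn_mom (hD : IsOpen D) (h : ContDiffOn ℝ ∞ ℒ D) (μ : Fin n) (i : Fin m) :
    ContDiffOn ℝ ∞ (mom ℒ μ i) D :=
  (h.fderiv_of_isOpen hD (m := ∞) (by simp)).clm_apply contDiffOn_const

theorem contDiffOn_legendre (hD : IsOpen D) (h : ContDiffOn ℝ ∞ ℒ D) :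
    ContDiffOn ℝ ∞ (legendre ℒ) D := by
  refine contDiff_fst.contDiffOn.prodMk ((contDiff_fst.comp contDiff_snd).contDiffOn.prodMk ?_)
  exact contDiffOn_pi.2 fun μ => contDiffOn_pi.2 fun i => contDiffOn_mom hD h μ i

theorem fderiv_legendre_apply (hm : ∀ μ i, DifferentiableAt ℝ (mom ℒ μ i) w)
    (u : Crd n (JetFib n (YFib m))) :
    fderiv ℝ (legendre ℒ) w u = (u.1, u.2.1, fun μ i => fderiv ℝ (mom ℒ μ i) w u) := by
  have h : HasFDerivAt (legendre ℒ) ((ContinuousLinearMap.fst ℝ (Fin n → ℝ)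
      (JetFib n (YFib m))).prod (((ContinuousLinearMap.fst ℝ (Fin m → ℝ) (Fin n → Fin m → ℝ)).comp
        (ContinuousLinearMap.snd ℝ (Fin n → ℝ) (JetFib n (YFib m)))).prod
      (ContinuousLinearMap.pi fun μ => ContinuousLinearMap.pi fun i =>
        fderiv ℝ (mom ℒ μ i) w))) w := by
    refine hasFDerivAt_fst.prodMk ((hasFDerivAt_fst.comp w hasFDerivAt_snd).prodMk ?_)
    exact hasFDerivAt_pi.2 fun μ => hasFDerivAt_pi.2 fun i => (hm μ i).hasFDerivAt
  rw [h.fderiv]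
  rfl

/-- The energy function `π^λ_i y^i_λ - ℒ`. -/
def energy (ℒ : Crd n (JetFib n (YFib m)) → ℝ) (z : Crd n (JetFib n (YFib m))) : ℝ :=
  (∑ μ, ∑ i, mom ℒ μ i z * z.2.2 μ i) - ℒ z

/-- `J¹Y` and `Π` have the same coordinate type, so `dp μ i` here plays the role of the covector
`dy^i_μ`. -/
theorem hasFDerivAt_energy (hℒ : DifferentiableAt ℝ ℒ w)
    (hm : ∀ μ i, DifferentiableAt ℝ (mom ℒ μ i) w) :
    HasFDerivAt (energy ℒ) ((∑ μ, ∑ i, (mom ℒ μ i w • dp μ i +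
      w.2.2 μ i • fderiv ℝ (mom ℒ μ i) w)) - fderiv ℝ ℒ w) w := by
  refine HasFDerivAt.sub (HasFDerivAt.fun_sum fun μ _ => HasFDerivAt.fun_sum fun i _ => ?_)
    hℒ.hasFDerivAt
  exact (hm μ i).hasFDerivAt.mul (dp (n := n) (m := m) μ i).hasFDerivAt

theorem sum_smul_vertVec (a : Fin n → Fin m → ℝ) :
    ∑ μ, ∑ i, a μ i • vertVec μ i = (0, 0, a) := by
  refine Prod.ext ?_ (Prod.ext ?_ ?_)
  · simp [vertVec, Prod.fst_sum]
  · simp [vertVec, Prod.fst_sum, Prod.snd_sum]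
  · ext ν j
    simp [vertVec, Prod.snd_sum, Finset.sum_apply, Pi.single_apply, ite_apply]

/-- Such a `u` is a combination of the vectors `∂/∂y^i_μ` along which every `π^μ_i` is stationary.
What remains of `dE` is `π^μ_i u^i_μ - dℒ(u)`, which vanishes by the definition of `π^μ_i`. -/
theorem fderiv_energy_eq_zero (hℒ : DifferentiableAt ℝ ℒ w)
    (hm : ∀ μ i, DifferentiableAt ℝ (mom ℒ μ i) w) {u : Crd n (JetFib n (YFib m))}
    (hu : fderiv ℝ (legendre ℒ) w u = 0) : fderiv ℝ (energy ℒ) w u = 0 := by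
  rw [fderiv_legendre_apply hm] at hu
  have h1 : u.1 = 0 := congrArg Prod.fst hu
  have h2 : u.2.1 = 0 := congrArg (fun q => q.2.1) hu
  have h3 : ∀ μ i, fderiv ℝ (mom ℒ μ i) w u = 0 := fun μ i =>
    congrFun (congrFun (congrArg (fun q => q.2.2) hu) μ) i
  have hu' : u = ∑ μ, ∑ i, u.2.2 μ i • vertVec μ i := by
    rw [sum_smul_vertVec]
    exact Prod.ext h1 (Prod.ext h2 rfl)
  have h4 : fderiv ℝ ℒ w u = ∑ μ, ∑ i, u.2.2 μ i * mom ℒ μ i w := by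
    conv_lhs => rw [hu']
    simp [mom]
  rw [(hasFDerivAt_energy hℒ hm).fderiv]
  simp [h3, h4, dp, mul_comm]

/-- The Legendre morphism lies over `Y`: it preserves `dx` and `dy`, and turns the coefficient
`p^μ_i` into `π^μ_i`. -/
theorem hamForm_legendre_compContinuousLinearMap (hm : ∀ μ i, DifferentiableAt ℝ (mom ℒ μ i) w)
    {ℋ : Crd n (LegFib n m) → ℝ} (h : ℋ (legendre ℒ w) = energy ℒ w) :
    (hamForm ℋ (legendre ℒ w)).compContinuousLinearMap (fderiv ℝ (legendre ℒ) w) =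
      poincareCartan ℒ w := by
  have hdx : ∀ ν : Fin n, (dx (G := LegFib n m) ν).comp (fderiv ℝ (legendre ℒ) w) = dx ν := by
    intro ν
    refine ContinuousLinearMap.ext fun u => ?_
    rw [ContinuousLinearMap.comp_apply, fderiv_legendre_apply hm]
    rfl
  have hdy : ∀ i : Fin m, (dy (W := Fin n → Fin m → ℝ) i).comp (fderiv ℝ (legendre ℒ) w) =
      dy i := by
    intro i
    refine ContinuousLinearMap.ext fun u => ?_
    rw [ContinuousLinearMap.comp_apply, fderiv_legendre_apply hm]
    rfl
  have hvol : (vol (G := LegFib n m)).compContinuousLinearMap (fderiv ℝ (legendre ℒ) w) =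
      vol := by
    rw [vol, wedge_compContinuousLinearMap]
    simp only [hdx]
  have hat : ∀ (μ : Fin n) (i : Fin m), (wedgeVolAt (dy (W := Fin n → Fin m → ℝ) i)
      μ).compContinuousLinearMap (fderiv ℝ (legendre ℒ) w) =
      wedgeVolAt (dy (W := Fin n → Fin m → ℝ) i) μ := by
    intro μ i
    rw [wedgeVolAt, wedge_compContinuousLinearMap]
    congr 1
    ext1 ν
    rcases eq_or_ne ν μ with rfl | hν
    · simp only [Function.update_self, hdy]
    · simp only [Function.update_of_ne hν, hdx]
  simp only [hamForm, sub_compContinuousLinearMap, sum_compContinuousLinearMap,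
    smul_compContinuousLinearMap, hat, hvol, h]
  rw [poincareCartan, energy, sub_smul _ _ (vol (n := n) (G := LegFib n m))]
  change ∑ μ, ∑ i, mom ℒ μ i w • _ - _ = _
  abel

theorem differentiableAt_hamForm {ℋ : Crd n (LegFib n m) → ℝ} {q : Crd n (LegFib n m)}
    (hℋ : DifferentiableAt ℝ ℋ q) : DifferentiableAt ℝ (hamForm ℋ) q := by
  refine DifferentiableAt.sub (DifferentiableAt.fun_sum fun μ _ =>
    DifferentiableAt.fun_sum fun i _ => ?_) (hℋ.smul_const _)
  exact (dp (n := n) (m := m) μ i).differentiableAt.smul_const _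

/-- `dp^μ_i` pulls back to the full differential of `π^μ_i`, whereas `Ω_L` omits its `dx` part; the
difference dies against `ω`. -/
theorem multisymplectic_compContinuousLinearMap (hm : ∀ μ i, DifferentiableAt ℝ (mom ℒ μ i) w)
    (μ : Fin n) :
    (multisymplectic (n := n) (m := m) μ).compContinuousLinearMap (fderiv ℝ (legendre ℒ) w) =
      lagMultisymplectic ℒ w μ := by
  rw [multisymplectic, sum_compContinuousLinearMap, lagMultisymplectic]
  refine Finset.sum_congr rfl fun i _ => ?_
  rw [wedge_compContinuousLinearMap]
  refine Eq.trans ?_ (wedge_cons_add_sum (E := Crd n (LegFib n m)) _ dx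
    (Fin.cons (dy i) dx : Fin (n + 1) → Crd n (LegFib n m) →L[ℝ] ℝ) (fun ν => fderiv ℝ (mom ℒ μ i) w (e ν, 0)) Fin.succ (fun ν => by simp))
  congr 1
  ext1 j
  refine Fin.cases ?_ (fun j => Fin.cases ?_ (fun j => ?_) j) j
  · refine ContinuousLinearMap.ext fun u => ?_
    have hu : u = (0, u.2) + ∑ ν, u.1 ν • ((e ν, 0) : Crd n (JetFib n (YFib m))) := by
      refine Prod.ext ?_ ?_
      · ext ν
        simp [e, Prod.fst_sum, Pi.single_apply]
      · simp [Prod.snd_sum]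
    simp only [Fin.cons_zero, ContinuousLinearMap.comp_apply, fderiv_legendre_apply hm]
    change fderiv ℝ (mom ℒ μ i) w u = _
    conv_lhs => rw [hu]
    rw [map_add, map_sum]
    simp only [map_smul, smul_eq_mul]
    simp [dx, mul_comm]
  · refine ContinuousLinearMap.ext fun u => ?_
    simp only [Fin.cons_succ, Fin.cons_zero, ContinuousLinearMap.comp_apply,
      fderiv_legendre_apply hm]
    rfl
  · refine ContinuousLinearMap.ext fun u => ?_
    simp only [Fin.cons_succ, ContinuousLinearMap.comp_apply, fderiv_legendre_apply hm]
    rfl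

/-- The derivative of the commutative square `jetProj ∘ J¹Φ = Φ ∘ jetProj`. Since `J¹Φ` involves
first derivatives of `Φ`, the chain rule asks for `Φ` of class `C²`. -/
theorem jetProj_comp_fderiv_jetProlongation {G G' : Type} [NormedAddCommGroup G]
    [NormedSpace ℝ G] [NormedAddCommGroup G'] [NormedSpace ℝ G'] {Φ : Crd n G → Crd n G'}
    {z : Crd n (JetFib n G)} (hΦ : ContDiffAt ℝ 2 Φ (jetProj z)) (hfst : ∀ x, (Φ x).1 = x.1) :
    (jetProj (n := n) (G := G')).comp (fderiv ℝ (jetProlongation Φ) z) =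
      (fderiv ℝ Φ (jetProj z)).comp jetProj := by
  have hj : ∀ {G : Type} [NormedAddCommGroup G] [NormedSpace ℝ G] (z : Crd n (JetFib n G)),
      DifferentiableAt ℝ (jetProj (n := n) (G := G)) z := fun z =>
    ContinuousLinearMap.differentiableAt _
  have h1 : DifferentiableAt ℝ Φ (jetProj z) := hΦ.differentiableAt (by simp)
  have h1' : DifferentiableAt ℝ (fun z : Crd n (JetFib n G) => Φ (jetProj z)) z :=
    h1.comp z (hj _)
  have h2 : DifferentiableAt ℝ (fun z : Crd n (JetFib n G) => fderiv ℝ Φ (jetProj z)) z :=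
    ((hΦ.fderiv_right (m := 1) (by norm_num)).differentiableAt (by simp)).comp z
      (hj _)
  have hd : DifferentiableAt ℝ (jetProlongation Φ) z := by
    refine differentiableAt_fst.prodMk (h1'.snd.prodMk (differentiableAt_pi.2 fun μ => ?_))
    refine (h2.clm_apply ?_).snd
    exact (differentiableAt_const _).prodMk
      (differentiableAt_pi.1 (differentiableAt_snd.snd) μ)
  have hc : jetProj ∘ jetProlongation Φ = Φ ∘ jetProj := by
    ext1 y
    exact Prod.ext (hfst (jetProj y)).symm rfl
  have hj' : ∀ {G : Type} [NormedAddCommGroup G] [NormedSpace ℝ G] (z : Crd n (JetFib n G)),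
      fderiv ℝ (jetProj (n := n) (G := G)) z = jetProj := fun z => ContinuousLinearMap.fderiv _
  have h := congrArg (fun f => fderiv ℝ f z) hc
  rwa [fderiv_comp z (hj _) hd, fderiv_comp z h1 (hj _), hj', hj'] at h

/-- `Λ_L` is the pullback of `ℰ_H` if, modulo closed forms, `H = p^λ_i dy^i ∧ ω_λ - ℋ ω` with
`ℋ ∘ L̂ = π^λ_i y^i_λ - ℒ`. -/
theorem lagrangeForm_eq_of_energy (hD : IsOpen D) (hℒ : ContDiffOn ℝ ∞ ℒ D)
    {H : Crd n (LegFib n m) → Crd n (LegFib n m) [⋀^Fin n]→L[ℝ] ℝ} {ℋ : Crd n (LegFib n m) → ℝ}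
    {z : Crd n (JetFib n (JetFib n (YFib m)))} (hz : jetProj z ∈ D)
    (hℋ : DifferentiableAt ℝ ℋ (legendre ℒ (jetProj z)))
    (hH : extDeriv H (legendre ℒ (jetProj z)) = extDeriv (hamForm ℋ) (legendre ℒ (jetProj z)))
    (hE : ∀ w ∈ D, ℋ (legendre ℒ w) = energy ℒ w) :
    lagrangeForm ℒ z = (hamiltonOperator H
      (jetProlongation (legendre ℒ) z)).compContinuousLinearMap
        (fderiv ℝ (jetProlongation (legendre ℒ)) z) := by
  have hm : ∀ w ∈ D, ∀ μ i, DifferentiableAt ℝ (mom ℒ μ i) w := fun w hw μ i =>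
    ((contDiffOn_mom hD hℒ μ i).contDiffAt (hD.mem_nhds hw)).differentiableAt (by simp)
  have hΦ : ContDiffAt ℝ ∞ (legendre ℒ) (jetProj z) :=
    (contDiffOn_legendre hD hℒ).contDiffAt (hD.mem_nhds hz)
  have hPC : (extDeriv H (legendre ℒ (jetProj z))).compContinuousLinearMap
      (fderiv ℝ (legendre ℒ) (jetProj z)) = extDeriv (poincareCartan ℒ) (jetProj z) := by
    -- The two `n`-forms are differentiated after the pullback, so they must agree near `jetProj z`:
    -- this is why `hE` is required on all of `D`, while `hH` concerns a single point.
    rw [hH, ← extDeriv_pullback (differentiableAt_hamForm hℋ) hΦ (by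
      rw [minSmoothness_of_isRCLikeNormedField]; norm_cast)]
    refine Filter.EventuallyEq.extDeriv_eq ?_
    filter_upwards [hD.mem_nhds hz] with w hw
    exact hamForm_legendre_compContinuousLinearMap (hm w hw) (hE w hw)
  have hlift : horizontalLift (jetProlongation (legendre ℒ) z).2.2 =
      fun μ => fderiv ℝ (legendre ℒ) (jetProj z) (horizontalLift z.2.2 μ) := by
    ext1 μ
    -- The fibre component is the definition of `J¹L̂`; the base component is `e μ` because `L̂`
    -- covers the identity of the base.
    refine Prod.ext ?_ rfl
    rw [fderiv_legendre_apply (hm _ hz)]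
    rfl
  have hcontr : (contract (horizontalLift (jetProlongation (legendre ℒ) z).2.2)
      (multisymplectic (n := n) (m := m))).compContinuousLinearMap
        (fderiv ℝ (legendre ℒ) (jetProj z)) =
      contract (horizontalLift z.2.2) (lagMultisymplectic ℒ (jetProj z)) := by
    rw [hlift, contract_compContinuousLinearMap]
    simp only [multisymplectic_compContinuousLinearMap (hm _ hz)]
  calc lagrangeForm ℒ z
      = ((extDeriv H (legendre ℒ (jetProj z)) -
          contract (horizontalLift (jetProlongation (legendre ℒ) z).2.2)
            multisymplectic).compContinuousLinearMap
              (fderiv ℝ (legendre ℒ) (jetProj z))).compContinuousLinearMap jetProj := by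
        rw [sub_compContinuousLinearMap, hPC, hcontr, lagrangeForm]
    _ = (extDeriv H (legendre ℒ (jetProj z)) -
          contract (horizontalLift (jetProlongation (legendre ℒ) z).2.2)
            multisymplectic).compContinuousLinearMap
              ((fderiv ℝ (legendre ℒ) (jetProj z)).comp jetProj) := rfl
    _ = _ := by
        rw [← jetProj_comp_fderiv_jetProlongation (hΦ.of_le (by norm_cast))
          fun _ => rfl]
        rfl

end Legendre

/-! ### Hamiltonian forms -/

section Hamiltonian

variable {n m : ℕ} {U : Set (Crd n (LegFib n m))}
  {H : Crd n (LegFib n m) → Crd n (LegFib n m) [⋀^Fin n]→L[ℝ] ℝ}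

/-- The fibre components of `Ĥ` are values of `dH` on constant vectors, up to sign. Their smoothness
makes `ℋ` differentiable, as is needed to take `d` of its Hamiltonian form. -/
theorem contDiffOn_momentumMorphism (hU : IsOpen U) (h : ContDiffOn ℝ ∞ H U) :
    ContDiffOn ℝ ∞ (momentumMorphism H) U := by
  have hA : ContDiff ℝ ∞ (ContinuousAlternatingMap.alternatizeUncurryFinCLM ℝ
      (Crd n (LegFib n m)) ℝ (n := n)) := ContinuousLinearMap.contDiff _
  have hd : ContDiffOn ℝ ∞ (extDeriv H) U :=
    hA.comp_contDiffOn (h.fderiv_of_isOpen hU (m := ∞) (by simp))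
  refine contDiff_fst.contDiffOn.prodMk ((contDiff_fst.comp contDiff_snd).contDiffOn.prodMk ?_)
  refine contDiffOn_pi.2 fun μ => contDiffOn_pi.2 fun i => ContDiffOn.neg ?_
  exact (ContinuousAlternatingMap.apply ℝ (Crd n (LegFib n m)) ℝ _).contDiff.comp_contDiffOn hd

/-- The Hamiltonian function `p^λ_i Φ^i_λ - ℒ ∘ Φ` of the form `H_Φ + L ∘ Φ`. -/
def hamiltonian (ℒ : Crd n (JetFib n (YFib m)) → ℝ)
    (Φ : Crd n (LegFib n m) → Crd n (JetFib n (YFib m))) (q : Crd n (LegFib n m)) : ℝ :=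
  (∑ μ, ∑ i, q.2.2 μ i * (Φ q).2.2 μ i) - ℒ (Φ q)

theorem hamForm_hamiltonian (ℒ : Crd n (JetFib n (YFib m)) → ℝ)
    (Φ : Crd n (LegFib n m) → Crd n (JetFib n (YFib m))) (q : Crd n (LegFib n m)) :
    hamForm (hamiltonian ℒ Φ) q = momentumForm Φ q + ℒ (Φ q) • vol := by
  rw [momentumForm, hamForm, hamForm, hamiltonian,
    sub_smul _ _ (vol (n := n) (G := LegFib n m))]
  abel

theorem differentiableAt_hamiltonian {ℒ : Crd n (JetFib n (YFib m)) → ℝ}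
    {Φ : Crd n (LegFib n m) → Crd n (JetFib n (YFib m))} {q : Crd n (LegFib n m)}
    (hℒ : DifferentiableAt ℝ ℒ (Φ q)) (hΦ : DifferentiableAt ℝ Φ q) :
    DifferentiableAt ℝ (hamiltonian ℒ Φ) q := by
  refine DifferentiableAt.sub (DifferentiableAt.fun_sum fun μ _ =>
    DifferentiableAt.fun_sum fun i _ => ?_) (hℒ.comp q hΦ)
  -- The first `dp μ i` is the momentum coordinate on `Π`; the second, composed with `Φ`, reads off
  -- the jet coordinate `y^i_μ` on `J¹Y`.
  exact (dp (n := n) (m := m) μ i).differentiableAt.mul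
    ((dp (n := n) (m := m) μ i).differentiableAt.comp q hΦ)

end Hamiltonian

/-! ### Associated Hamiltonian forms -/

section Associated

variable {n m : ℕ} {X Y : Type*}
  [TopologicalSpace X] [ChartedSpace (EuclideanSpace ℝ (Fin n)) X]
  [TopologicalSpace Y] [ChartedSpace (EuclideanSpace ℝ (Fin (n + m))) Y]
  {π : Y → X}

theorem FibredChart.isOpen_dom {W : Type} [NormedAddCommGroup W] (c : FibredChart n m π) :
    IsOpen (c.dom (W := W)) :=
  c.chartY.open_target.preimage (by fun_prop)

variable [IsFibredManifold n m π] {L : LagrangianDensity n m π} {H : LegendreForm n m π n}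

theorem LagrangianDensity.differentiableAt_loc (L : LagrangianDensity n m π)
    (c : FibredChart n m π) {w : Crd n (JetFib n (YFib m))} (hw : w ∈ c.dom) :
    DifferentiableAt ℝ (L.loc c) w :=
  ((L.smooth c).contDiffAt (c.isOpen_dom.mem_nhds hw)).differentiableAt (by simp)

theorem LagrangianDensity.differentiableAt_mom (L : LagrangianDensity n m π)
    (c : FibredChart n m π) {w : Crd n (JetFib n (YFib m))} (hw : w ∈ c.dom)
    (μ : Fin n) (i : Fin m) : DifferentiableAt ℝ (mom (L.loc c) μ i) w :=
  ((contDiffOn_mom c.isOpen_dom (L.smooth c) μ i).contDiffAt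
    (c.isOpen_dom.mem_nhds hw)).differentiableAt (by simp)

/-- The energy of a semiregular Lagrangian density is constant on the fibres of the Legendre
morphism. -/
theorem LagrangianDensity.IsSemiregular.energy_eq (hL : L.IsSemiregular) (c : FibredChart n m π)
    {w w' : Crd n (JetFib n (YFib m))} (hw : w ∈ c.dom) (hw' : w' ∈ c.dom)
    (h : legendre (L.loc c) w' = legendre (L.loc c) w) :
    energy (L.loc c) w' = energy (L.loc c) w := by
  obtain ⟨hconn, hsub⟩ := hL c _ (mem_image_of_mem _ hw)
  refine hsub.eq_of_ker_le hconn.isPreconnected (P := legendre (L.loc c))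
    (fun x hx => ?_) (fun x hx => ?_) (fun x hx => hx.2) (fun x hx u hu => ?_) ⟨hw', h⟩ ⟨hw, rfl⟩
  · exact (hasFDerivAt_energy (L.differentiableAt_loc c hx.1)
      (L.differentiableAt_mom c hx.1)).differentiableAt
  · exact ((contDiffOn_legendre c.isOpen_dom (L.smooth c)).contDiffAt
      (c.isOpen_dom.mem_nhds hx.1)).differentiableAt (by simp)
  · exact fderiv_energy_eq_zero (L.differentiableAt_loc c hx.1)
      (L.differentiableAt_mom c hx.1) hu

/-- The only use of semiregularity: it allows `w` to be replaced by the point `Ĥ (L̂ w)` of the same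
fibre. There the momenta `π^μ_i` equal the coordinates `p^μ_i` of `L̂ w`, and the two expressions
coincide term by term. -/
theorem LegendreForm.IsAssociated.hamiltonian_legendre (hHL : H.IsAssociated L)
    (hL : L.IsSemiregular) (c : FibredChart n m π) {w : Crd n (JetFib n (YFib m))}
    (hw : w ∈ c.dom) :
    hamiltonian (L.loc c) (momentumMorphism (H.loc c)) (legendre (L.loc c) w) =
      energy (L.loc c) w := by
  have hid := hHL.legendre_momentum c _ (mem_image_of_mem _ hw)
  -- The second `hw` serves for `Ĥ (L̂ w)`: membership in `c.dom` depends on `(x, y)` only, which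
  -- both morphisms preserve.
  rw [← hL.energy_eq c hw (w' := momentumMorphism (H.loc c) (legendre (L.loc c) w)) hw hid]
  have hmom : ∀ μ i, mom (L.loc c) μ i (momentumMorphism (H.loc c) (legendre (L.loc c) w)) =
      mom (L.loc c) μ i w := fun μ i =>
    congrFun (congrFun (congrArg (fun q : Crd n (LegFib n m) => q.2.2) hid) μ) i
  simp only [hamiltonian, energy, hmom]
  rfl

theorem differentiableAt_hamiltonian_momentumMorphism (H : LegendreForm n m π n)
    (L : LagrangianDensity n m π) (c : FibredChart n m π) {q : Crd n (LegFib n m)}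
    (hq : q ∈ c.dom) :
    DifferentiableAt ℝ (hamiltonian (L.loc c) (momentumMorphism (H.loc c))) q :=
  differentiableAt_hamiltonian (L.differentiableAt_loc c hq)
    (((contDiffOn_momentumMorphism c.isOpen_dom (H.smooth c)).contDiffAt
      (c.isOpen_dom.mem_nhds hq)).differentiableAt (by simp))

theorem LegendreForm.IsAssociated.extDeriv_eq (hHL : H.IsAssociated L) (c : FibredChart n m π)
    {q : Crd n (LegFib n m)} (hq : q ∈ c.dom) :
    extDeriv (H.loc c) q =
      extDeriv (hamForm (hamiltonian (L.loc c) (momentumMorphism (H.loc c)))) q := by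
  have h := hHL.eq_mod_closed c q hq
  simp only [← hamForm_hamiltonian] at h
  have hd : DifferentiableAt ℝ (H.loc c) q :=
    ((H.smooth c).contDiffAt (c.isOpen_dom.mem_nhds hq)).differentiableAt (by simp)
  -- Differentiability of both forms is what allows `d` of their difference to be split.
  have hd' := differentiableAt_hamForm (differentiableAt_hamiltonian_momentumMorphism H L c hq)
  rw [extDeriv, fderiv_fun_sub hd hd', ← ContinuousAlternatingMap.alternatizeUncurryFinCLM_apply,
    map_sub] at h
  exact sub_eq_zero.1 h

end Associated

end Multimomentum

end

open Multimomentum in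
theorem proposition9 (n m : ℕ) {X Y : Type*}
    [TopologicalSpace X] [T2Space X] [SecondCountableTopology X] [ConnectedSpace X]
    [ChartedSpace (EuclideanSpace ℝ (Fin n)) X] [IsManifold (𝓡 n) ∞ X]
    [TopologicalSpace Y] [T2Space Y] [SecondCountableTopology Y] [ConnectedSpace Y]
    [ChartedSpace (EuclideanSpace ℝ (Fin (n + m))) Y] [IsManifold (𝓡 (n + m)) ∞ Y]
    (π : Y → X) [IsFibredManifold n m π]
    (L : LagrangianDensity n m π) (hL : L.IsSemiregular)
    (H : LegendreForm n m π n) (hH : H.IsHamiltonian) (hHL : H.IsAssociated L)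
    (c : FibredChart n m π) (z : Crd n (JetFib n (JetFib n (YFib m))))
    (hz : jetProj z ∈ c.dom (W := Fin n → Fin m → ℝ)) :
    lagrangeForm (L.loc c) z =
      (hamiltonOperator (H.loc c)
        (jetProlongation (legendre (L.loc c)) z)).compContinuousLinearMap
          (fderiv ℝ (jetProlongation (legendre (L.loc c))) z) := by
  exact lagrangeForm_eq_of_energy c.isOpen_dom (L.smooth c) hz
    -- `hz` is also the membership of `L̂ (jetProj z)` in the chart domain of `Π`, by the same
    -- dependence on `(x, y)` only.
    (differentiableAt_hamiltonian_momentumMorphism H L c hz) (hHL.extDeriv_eq c hz)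
    fun w hw => hHL.hamiltonian_legendre hL c hw
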